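/- Write $\mathbb{N}=\{1,2,\dots\}$, $\omega=\mathbb{N}\cup\{0\}$, and let $\mathcal{P}_f(X)$ be the set of finite nonempty subsets of $X$. Let $S$ be a dense subsemigroup of $((0,\infty),+)$, and let $\tau_0$ be the set of all sequences in $S$ that converge to $0$. **Definitions.** A set $A\subseteq S$ is a *C-set near zero* if for each $\delta\in(0,1)$ there are functions $\alpha_\delta:\mathcal{P}_f(\tau_0)\to S$ and $H_\delta:\mathcal{P}_f(\tau_0)\to\mathcal{P}_f(\mathbb{N})$ such that (1) $\alpha_\delta(F)<\delta$ for all $F$; (2) $\max H_\delta(F)<\min H_\delta(G)$ whenever $F\subsetneq G$; and (3) whenever $m\in\mathbb{N}$, $G_1\subsetneq G_2\subsetneq\cdots\subsetneq G_m$ are in $\mathcal{P}_f(\tau_0)$ and $f_i\in G_i$ for $i=1,\dots,m$, one has $$\sum_{i=1}^m\Big(\alpha_\delta(G_i)+\sum_{t\in H_\delta(G_i)}f_i(t)\Big)\in A\cap(0,\delta).$$ A set $A\subseteq S$ is a *J-set near zero* if for all $F\in\mathcal{P}_f(\tau_0)$ and $\delta>0$ there are $a\in S\cap(0,\delta)$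 and $H\in\mathcal{P}_f(\mathbb{N})$ with $a+\sum_{t\in H}f(t)\in A$ for all $f\in F$. Let $\beta S$ be the set of ultrafilters on $S$, with $B\in p+q$ if and only if $\{x\in S:\{y\in S:x+y\in B\}\in q\}\in p$. Let $J_0(S)$ be the set of those $p\in\beta S$ that contain $(0,\varepsilon)\cap S$ for every $\varepsilon>0$ and all of whose members are J-sets near zero. A set $A\subseteq S$ is a *C\*-set near zero* if it belongs to every $p\in J_0(S)$ with $p+p=p$. A *first entry* of a matrix is the first nonzero entry of one of its rows. A $u\times v$ matrix $M=(m_{i,j})$ is a *first entries matrix* if no row of $M$ is zero and there are positive rationals $d_1,\dots,d_v$ such that $m_{i,l}=d_l$ whenever $l$ is the least index with $m_{i,l}\neq0$. **Theorem 2.8.** Let $S$ be a dense subsemigroup of $((0,\infty),+)$, let $u,v\in\mathbb{N}$, and let $M$ be a $u\times v$ first entries matrix with entries from $\omega$. Let $A\subseteq S$ be a C-set near zero. If $cS$ is a C\*-set near zero for every first entry $c$ of $M$, then there are sequences $\langle x_{1,n}\rangle_{n=1}^\infty,\dots,\langle x_{v,n}\rangle_{n=1}^\infty$ in $\tau_0$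 such that for every $F\in\mathcal{P}_f(\mathbb{N})$ one has $\vec x_F\in(S\setminus\{0\})^v$ and $M\vec x_F\in A^u$, where $$\vec x_F=\Big(\sum_{n\in F}x_{1,n},\ \dots,\ \sum_{n\in F}x_{v,n}\Big)^{T}.$$ -/

import Mathlib

open Filter Topology

namespace NearZero

/-- `S` is a dense subsemigroup of `((0,∞), +)`. -/
def IsDenseSubsemigroup (S : AddSubsemigroup ℝ) : Prop :=
  (∀ x ∈ S, 0 < x) ∧ Set.Ioi (0 : ℝ) ⊆ closure (S : Set ℝ)

/-- The set `τ₀` of all sequences in `S` that converge to zero. -/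
def tauZero (S : AddSubsemigroup ℝ) : Set (ℕ → ℝ) :=
  {f | (∀ n, f n ∈ S) ∧ Tendsto f atTop (𝓝 0)}

/-- `P_f(τ₀)`: the finite nonempty subsets of `τ₀`. -/
def finTau (S : AddSubsemigroup ℝ) : Set (Finset (ℕ → ℝ)) :=
  {F | F.Nonempty ∧ (F : Set (ℕ → ℝ)) ⊆ tauZero S}

/-- `A ⊆ S` is a J-set near zero. -/
def IsJSet (S : AddSubsemigroup ℝ) (A : Set ℝ) : Prop :=
  A ⊆ S ∧ ∀ F ∈ finTau S, ∀ δ : ℝ, 0 < δ →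
    ∃ a ∈ (S : Set ℝ) ∩ Set.Ioo 0 δ, ∃ H : Finset ℕ, H.Nonempty ∧
      ∀ f ∈ F, a + ∑ t ∈ H, f t ∈ A

/-- `A ⊆ S` is a C-set near zero: for each `δ ∈ (0,1)` there are functions `α` and `H` on
`P_f(τ₀)`, with values in `S` and in the finite nonempty sets of indices, as in the central sets
theorem near zero, the sums being found in the part `A ∩ (0,δ)` of `A`. -/
def IsCSet (S : AddSubsemigroup ℝ) (A : Set ℝ) : Prop :=
  A ⊆ S ∧ ∀ δ : ℝ, 0 < δ → δ < 1 →
    ∃ (α : Finset (ℕ → ℝ) → ℝ) (H : Finset (ℕ → ℝ) → Finset ℕ),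
      (∀ F ∈ finTau S, α F ∈ S ∧ α F < δ ∧ (H F).Nonempty) ∧
      (∀ F ∈ finTau S, ∀ G ∈ finTau S, F ⊂ G → ∀ s ∈ H F, ∀ t ∈ H G, s < t) ∧
      (∀ m : ℕ, 0 < m → ∀ (G : Fin m → Finset (ℕ → ℝ)) (f : Fin m → ℕ → ℝ),
        (∀ i, G i ∈ finTau S) → (∀ i j, i < j → G i ⊂ G j) → (∀ i, f i ∈ G i) →
        ∑ i, (α (G i) + ∑ t ∈ H (G i), f i t) ∈ A ∩ Set.Ioo 0 δ)

/-- `O⁺(S)`: the ultrafilters on (the discrete set) `S` that contain `(0,ε) ∩ S` for all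
`ε > 0`. -/
def zeroPlus (S : AddSubsemigroup ℝ) : Set (Ultrafilter S) :=
  {p | ∀ ε : ℝ, 0 < ε → {x : S | 0 < (x : ℝ) ∧ (x : ℝ) < ε} ∈ p}

/-- `J₀(S)`: the members of `O⁺(S)` all of whose elements are J-sets near zero. -/
def jZero (S : AddSubsemigroup ℝ) : Set (Ultrafilter S) :=
  {p | p ∈ zeroPlus S ∧ ∀ B : Set S, B ∈ p → IsJSet S (Subtype.val '' B)}

section
attribute [local instance] Ultrafilter.add

/-- `A ⊆ S` is a C*-set near zero: it is a member of every idempotent of `J₀(S)`. Addition on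
`βS` is Mathlib's: `B ∈ p + q` iff `{x | {y | x + y ∈ B} ∈ q} ∈ p`. -/
def IsCStarSet (S : AddSubsemigroup ℝ) (A : Set ℝ) : Prop :=
  A ⊆ S ∧ ∀ p : Ultrafilter S, p ∈ jZero S → p + p = p → (Subtype.val ⁻¹' A : Set S) ∈ p

end

/-- `c` is a first entry of `M`: the first nonzero entry of some row. -/
def IsFirstEntry {R : Type*} [Zero R] {u v : ℕ} (M : Matrix (Fin u) (Fin v) R) (c : R) : Prop :=
  ∃ i l, M i l = c ∧ c ≠ 0 ∧ ∀ j < l, M i j = 0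

/-- First entries matrix: no row is zero, and there are positive rationals `d₁, …, d_v` such that
whenever the first nonzero entry of row `i` is in column `l`, it equals `d_l`. -/
def IsFirstEntriesMatrix {u v : ℕ} (M : Matrix (Fin u) (Fin v) ℚ) : Prop :=
  (∀ i, ∃ j, M i j ≠ 0) ∧
    ∃ d : Fin v → ℚ, (∀ l, 0 < d l) ∧
      ∀ i l, M i l ≠ 0 → (∀ j < l, M i j = 0) → M i l = d l

end NearZero

/-!
A C-set near zero `A` belongs to some idempotent `p` of `J₀(S)` (`IsCSet.exists_idempotent`), and
the C*-hypothesis puts `cS` into the same `p` for every first entry `c`. From there the proof is an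
induction on the columns of the matrix.

To find `p`, use the functions `α`, `H` for the single value `δ = 1/2`. The sums along chains in
`P_f(τ₀)` that start above a finite set `K` form a set `chainSums S α H K ⊆ A`. Each of these is a
J-set near zero: along a chain of length `m` the values of `α` add up to less than `δ`, so one of
them is below `δ / m` (`isJSet_chainSums`). J-sets near zero are partition regular by the
Hales–Jewett theorem (`IsJSet.of_union`), so some ultrafilter contains all the sets of chain sums
and consists of J-sets. Such ultrafilters form a compact subsemigroup of `βS`, since chains can be
concatenated (`exists_add_mem_chainSums`), and the Ellis–Numakura lemma yields `p`. A device used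
throughout is that a J-set near zero has small witnesses: passing to a common subsequence along
which the given sequences decay geometrically makes every sum `∑ t ∈ H, f t` small
(`IsJSet.exists_small`).

With `p` at hand, the recursion of Hindman's theorem gives a central sets theorem
(`exists_central_sequences`): for finitely many sequences `y` in `τ₀ ∪ {0}` there are a sequence `z`
in `τ₀` and successive blocks `H n` of indices such that all finite sums of
`c * z n + ∑ t ∈ H n, y t` lie in `A`. In the induction step, `c` is the first entry belonging to
the first column, the `y` are the combinations of the sequences already found that the rows
prescribe, `z` serves the new column, and the old sequences are replaced by their sums over the
blocks `H n`, which preserves the conclusion for the rows that vanish in the first column.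
-/

namespace NearZero

variable {S : AddSubsemigroup ℝ}

/-! ### Sums in `S` and sequences in `τ₀` -/

/-- `S ∪ {0}`, a submonoid of `ℝ`. -/
def adjoinZero (S : AddSubsemigroup ℝ) : AddSubmonoid ℝ where
  carrier := insert 0 S
  zero_mem' := Set.mem_insert _ _
  add_mem' := by
    rintro a b (rfl | ha) (rfl | hb)
    · simp
    · simpa using Or.inr hb
    · simpa using Or.inr ha
    · exact Or.inr (S.add_mem ha hb)

theorem mem_adjoinZero {x : ℝ} (hx : x ∈ S) : x ∈ adjoinZero S := Or.inr hx

theorem add_mem_of_mem_adjoinZero {a x : ℝ} (ha : a ∈ S) (hx : x ∈ adjoinZero S) :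
    a + x ∈ S := by
  rcases hx with rfl | hx
  · simpa using ha
  · exact S.add_mem ha hx

theorem sum_mem_of_nonempty {ι : Type*} {H : Finset ι} (hH : H.Nonempty) {f : ι → ℝ}
    (hf : ∀ t ∈ H, f t ∈ S) : ∑ t ∈ H, f t ∈ S := by
  classical
  obtain ⟨s, hs⟩ := hH
  rw [← Finset.add_sum_erase H f hs]
  exact add_mem_of_mem_adjoinZero (hf s hs)
    (sum_mem fun t ht => mem_adjoinZero (hf t (Finset.mem_of_mem_erase ht)))

/-- `τ₀ ∪ {0}`, a submonoid of the real sequences. -/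
def adjoinZeroTau (S : AddSubsemigroup ℝ) : AddSubmonoid (ℕ → ℝ) where
  carrier := insert 0 (tauZero S)
  zero_mem' := Set.mem_insert _ _
  add_mem' := by
    rintro a b (rfl | ha) (rfl | hb)
    · simp
    · simpa using Or.inr hb
    · simpa using Or.inr ha
    · have h := ha.2.add hb.2
      rw [add_zero] at h
      exact Or.inr ⟨fun n => S.add_mem (ha.1 n) (hb.1 n), h⟩

theorem mem_adjoinZeroTau {f : ℕ → ℝ} (hf : f ∈ tauZero S) : f ∈ adjoinZeroTau S := Or.inr hf

theorem add_mem_tauZero {f y : ℕ → ℝ} (hf : f ∈ tauZero S) (hy : y ∈ adjoinZeroTau S) :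
    f + y ∈ tauZero S := by
  rcases hy with rfl | hy
  · simpa using hf
  · have h := hf.2.add hy.2
    rw [add_zero] at h
    exact ⟨fun n => S.add_mem (hf.1 n) (hy.1 n), h⟩

theorem comp_mem_tauZero {f : ℕ → ℝ} (hf : f ∈ tauZero S) {φ : ℕ → ℕ}
    (hφ : Function.Injective φ) : f ∘ φ ∈ tauZero S :=
  ⟨fun n => hf.1 (φ n), hf.2.comp hφ.nat_tendsto_atTop⟩

theorem mem_tauZero_of_sum {ι : Type*} {K : Finset ι} (hK : K.Nonempty) {f : ι → ℕ → ℝ}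
    (hf : ∀ i ∈ K, f i ∈ tauZero S) : (fun n => ∑ i ∈ K, f i n) ∈ tauZero S :=
  ⟨fun n => sum_mem_of_nonempty hK fun i hi => (hf i hi).1 n,
    by simpa using tendsto_finsetSum K fun i hi => (hf i hi).2⟩

theorem mem_tauZero_of_lt {x : ℕ → ℝ} (hpos : ∀ s ∈ S, 0 < s) (hx : ∀ n, x n ∈ S)
    (hlt : ∀ n : ℕ, x n < 1 / ((n : ℝ) + 1)) : x ∈ tauZero S :=
  ⟨hx, squeeze_zero (fun n => (hpos _ (hx n)).le) (fun n => (hlt n).le)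
    tendsto_one_div_add_atTop_nhds_zero_nat⟩

theorem IsDenseSubsemigroup.tauZero_nonempty (hS : IsDenseSubsemigroup S) :
    (tauZero S).Nonempty := by
  have h : ∀ n : ℕ, ∃ s ∈ S, s < 1 / ((n : ℝ) + 1) := by
    intro n
    have hn : (0 : ℝ) < 1 / ((n : ℝ) + 1) := by positivity
    obtain ⟨s, hs, hsS⟩ := mem_closure_iff.1 (hS.2 (half_pos hn)) _ isOpen_Iio
      (Set.mem_Iio.2 (half_lt_self hn))
    exact ⟨s, hsS, hs⟩
  choose s hs hlt using h
  exact ⟨s, mem_tauZero_of_lt hS.1 hs hlt⟩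

theorem IsDenseSubsemigroup.exists_notMem (hS : IsDenseSubsemigroup S)
    {K : Finset (ℕ → ℝ)} (hK : (K : Set (ℕ → ℝ)) ⊆ tauZero S) : ∃ g ∈ tauZero S, g ∉ K := by
  obtain ⟨f, hf⟩ := hS.tauZero_nonempty
  refine ⟨f + ∑ k ∈ K, k, add_mem_tauZero hf (sum_mem fun k hk => mem_adjoinZeroTau (hK hk)), ?_⟩
  intro hg
  have h := Finset.single_le_sum (f := fun k : ℕ → ℝ => k 0)
    (fun k hk => (hS.1 _ ((hK hk).1 0)).le) hg
  have h0 := hS.1 _ (hf.1 0)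
  simp only [Pi.add_apply, Finset.sum_apply] at h
  linarith

/-! ### J-sets near zero -/

theorem IsJSet.mono {A B : Set ℝ} (hA : IsJSet S A) (hAB : A ⊆ B) (hB : B ⊆ S) :
    IsJSet S B :=
  ⟨hB, fun F hF δ hδ =>
    let ⟨a, ha, H, hH, h⟩ := hA.2 F hF δ hδ
    ⟨a, ha, H, hH, fun f hf => hAB (h f hf)⟩⟩

/-- In the definition of a J-set near zero, the indices may be required to be large and the sums
`∑ t ∈ H, f t` to be small. -/
theorem IsJSet.exists_small {A : Set ℝ} (hA : IsJSet S A) {F : Finset (ℕ → ℝ)}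
    (hF : F ∈ finTau S) {δ : ℝ} (hδ : 0 < δ) (k : ℕ) :
    ∃ a ∈ S, a < δ ∧ ∃ H : Finset ℕ, H.Nonempty ∧ (∀ t ∈ H, k < t) ∧
      ∀ f ∈ F, ∑ t ∈ H, f t < δ ∧ a + ∑ t ∈ H, f t ∈ A := by
  classical
  -- a common subsequence along which every `f ∈ F` decays geometrically
  have hev : ∀ n : ℕ, ∀ᶠ m in atTop, k < m ∧ ∀ f ∈ F, f m < δ / 2 * (1 / 2) ^ n := by
    intro n
    refine (eventually_gt_atTop k).and ?_
    rw [Filter.eventually_all_finset]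
    intro f hf
    exact (hF.2 hf).2.eventually (gt_mem_nhds (by positivity))
  obtain ⟨φ, hφ, hP⟩ := extraction_forall_of_eventually hev
  obtain ⟨a, ⟨haS, -, ha⟩, H, hH, h⟩ := hA.2 (F.image fun f => f ∘ φ)
    ⟨hF.1.image _, by
      intro g hg
      obtain ⟨f, hf, rfl⟩ := Finset.mem_image.1 (Finset.mem_coe.1 hg)
      exact comp_mem_tauZero (hF.2 hf) hφ.injective⟩ δ hδ
  refine ⟨a, haS, ha, H.image φ, hH.image _, ?_, fun f hf => ?_⟩
  · intro t ht
    obtain ⟨s, -, rfl⟩ := Finset.mem_image.1 ht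
    exact (hP s).1
  · rw [Finset.sum_image (hφ.injective.injOn)]
    refine ⟨?_, by simpa using h _ (Finset.mem_image_of_mem _ hf)⟩
    calc ∑ t ∈ H, f (φ t) < ∑ t ∈ H, δ / 2 * (1 / 2) ^ t :=
          Finset.sum_lt_sum_of_nonempty hH fun t _ => (hP t).2 f hf
      _ = δ / 2 * ∑ t ∈ H, (1 / 2 : ℝ) ^ t := by rw [Finset.mul_sum]
      _ ≤ δ / 2 * 2 := by
          refine mul_le_mul_of_nonneg_left ?_ (by positivity)
          exact (summable_geometric_two.sum_le_tsum H fun _ _ => by positivity).trans_eq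
            tsum_geometric_two
      _ = δ := by ring

/-- J-sets near zero are partition regular. If `F` is a finite set of sequences and the index set
`ι` is large enough for the Hales–Jewett theorem, apply the J-set property of `A ∪ B` to the
sequences `t ↦ ∑ i, w i (pair t i)`, one for each word `w : ι → F`. On a monochromatic line the
constant coordinates contribute to the translating element, the active ones to the new index
set. -/
theorem IsJSet.of_union (hpos : ∀ s ∈ S, 0 < s) {A B : Set ℝ} (h : IsJSet S (A ∪ B)) :
    IsJSet S A ∨ IsJSet S B := by
  classical
  have hAS : A ⊆ S := Set.subset_union_left.trans h.1
  have hBS : B ⊆ S := Set.subset_union_right.trans h.1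
  by_contra! hcon
  obtain ⟨hA, hB⟩ := hcon
  have hA' : ∃ F ∈ finTau S, ∃ δ : ℝ, 0 < δ ∧ ¬ ∃ a ∈ (S : Set ℝ) ∩ Set.Ioo 0 δ,
      ∃ H : Finset ℕ, H.Nonempty ∧ ∀ f ∈ F, a + ∑ t ∈ H, f t ∈ A := by
    by_contra! hc; exact hA ⟨hAS, hc⟩
  have hB' : ∃ F ∈ finTau S, ∃ δ : ℝ, 0 < δ ∧ ¬ ∃ a ∈ (S : Set ℝ) ∩ Set.Ioo 0 δ,
      ∃ H : Finset ℕ, H.Nonempty ∧ ∀ f ∈ F, a + ∑ t ∈ H, f t ∈ B := by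
    by_contra! hc; exact hB ⟨hBS, hc⟩
  obtain ⟨F₁, hF₁, δ₁, hδ₁, h₁⟩ := hA'
  obtain ⟨F₂, hF₂, δ₂, hδ₂, h₂⟩ := hB'
  set F := F₁ ∪ F₂ with hFdef
  have hFτ : ∀ f ∈ F, f ∈ tauZero S := by
    intro f hf
    rcases Finset.mem_union.1 hf with hf | hf
    · exact hF₁.2 hf
    · exact hF₂.2 hf
  obtain ⟨f₀, hf₀⟩ := hF₁.1
  have hf₀F : f₀ ∈ F := Finset.mem_union_left _ hf₀
  set δ := min δ₁ δ₂ with hδdef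
  have hδ : 0 < δ := lt_min hδ₁ hδ₂
  obtain ⟨ι, hι, hHJ⟩ := Combinatorics.Line.exists_mono_in_high_dimension F Prop
  have hne : Nonempty ι :=
    (hHJ fun _ => True).choose.proper.nonempty
  let e := Fintype.equivFin ι
  let idx : ℕ → ι → ℕ := fun t i => Nat.pair t (e i)
  have hidx : ∀ t i t' i', idx t i = idx t' i' → t = t' ∧ i = i' := by
    intro t i t' i' hh
    obtain ⟨h1, h2⟩ := Nat.pair_eq_pair.1 hh
    exact ⟨h1, e.injective (Fin.ext h2)⟩
  let g : (ι → F) → ℕ → ℝ := fun w t => ∑ i, (w i : ℕ → ℝ) (idx t i)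
  have hg : ∀ w, g w ∈ tauZero S := fun w =>
    mem_tauZero_of_sum (f := fun i t => (w i : ℕ → ℝ) (idx t i)) Finset.univ_nonempty
      fun i _ => comp_mem_tauZero (hFτ _ (w i).2) fun t t' hh => (hidx _ _ _ _ hh).1
  obtain ⟨a, haS, ha, H, hH, -, hsum⟩ := h.exists_small (F := Finset.univ.image g)
    ⟨⟨g fun _ => ⟨f₀, hf₀F⟩, Finset.mem_image_of_mem _ (Finset.mem_univ _)⟩, by
      intro f hf
      obtain ⟨w, -, rfl⟩ := Finset.mem_image.1 (Finset.mem_coe.1 hf)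
      exact hg w⟩ (half_pos hδ) 0
  have hsum' : ∀ w, ∑ t ∈ H, g w t < δ / 2 ∧ a + ∑ t ∈ H, g w t ∈ A ∪ B :=
    fun w => hsum _ (Finset.mem_image_of_mem _ (Finset.mem_univ _))
  obtain ⟨l, c, hc⟩ := hHJ fun w => a + ∑ t ∈ H, g w t ∈ A
  let V : Finset ι := Finset.univ.filter fun i => l.idxFun i = none
  have hV : V.Nonempty := l.proper.imp fun i hi => by simpa [V] using hi
  let w₀ : ι → F := l ⟨f₀, hf₀F⟩
  let b : ℝ := ∑ t ∈ H, ∑ i ∈ Vᶜ, (w₀ i : ℕ → ℝ) (idx t i)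
  have hb : b ∈ adjoinZero S := sum_mem fun t _ => sum_mem fun i _ =>
    mem_adjoinZero ((hFτ _ (w₀ i).2).1 _)
  let H' : Finset ℕ := (H ×ˢ V).image fun q => idx q.1 q.2
  have hH' : H'.Nonempty := (hH.product hV).image _
  have key : ∀ f : F, ∑ t ∈ H, g (l f) t = b + ∑ s ∈ H', (f : ℕ → ℝ) s := by
    intro f
    rw [Finset.sum_image (fun q _ q' _ hh => Prod.ext (hidx _ _ _ _ hh).1 (hidx _ _ _ _ hh).2),
      Finset.sum_product, ← Finset.sum_add_distrib]
    refine Finset.sum_congr rfl fun t _ => ?_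
    simp only [g]
    rw [← Finset.sum_add_sum_compl V, add_comm]
    congr 1
    · refine Finset.sum_congr rfl fun i hi => ?_
      have hi' : l.idxFun i ≠ none := by simpa [V] using hi
      obtain ⟨y, hy⟩ := Option.ne_none_iff_exists'.1 hi'
      simp only [w₀, l.apply_some hy]
    · refine Finset.sum_congr rfl fun i hi => ?_
      have hi' : l.idxFun i = none := by simpa [V] using hi
      rw [l.apply_none _ _ hi']
  have habS : a + b ∈ S := add_mem_of_mem_adjoinZero haS hb
  have habδ : a + b < δ := by
    have h1 := (hsum' (l ⟨f₀, hf₀F⟩)).1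
    rw [key] at h1
    have h2 : 0 < ∑ s ∈ H', f₀ s :=
      Finset.sum_pos (fun s _ => hpos _ ((hFτ f₀ hf₀F).1 s)) hH'
    simp only at h1
    linarith
  have hmem : ∀ f : F, (a + b + ∑ s ∈ H', (f : ℕ → ℝ) s) = a + ∑ t ∈ H, g (l f) t := by
    intro f; rw [key, add_assoc]
  by_cases hcol : c
  · refine h₁ ⟨a + b, ⟨habS, hpos _ habS, habδ.trans_le (min_le_left _ _)⟩, H', hH', ?_⟩
    intro f hf
    rw [hmem ⟨f, Finset.mem_union_left _ hf⟩]
    exact (hc ⟨f, Finset.mem_union_left _ hf⟩).mpr hcol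
  · refine h₂ ⟨a + b, ⟨habS, hpos _ habS, habδ.trans_le (min_le_right _ _)⟩, H', hH', ?_⟩
    intro f hf
    rw [hmem ⟨f, Finset.mem_union_right _ hf⟩]
    refine (hsum' _).2.resolve_left fun hA => hcol ?_
    exact (hc ⟨f, Finset.mem_union_right _ hf⟩).mp hA

/-! ### Ultrafilters of J-sets -/

theorem image_val_subset (B : Set S) : Subtype.val '' B ⊆ (S : Set ℝ) := by
  rintro _ ⟨x, -, rfl⟩
  exact x.2

theorem not_isJSet_empty (hS : IsDenseSubsemigroup S) : ¬ IsJSet S ∅ := by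
  intro h
  obtain ⟨f, hf⟩ := hS.tauZero_nonempty
  obtain ⟨a, -, H, -, h⟩ := h.2 {f} ⟨Finset.singleton_nonempty f, by simpa using hf⟩ 1 one_pos
  exact h f (Finset.mem_singleton_self f)

/-- Partition regularity in terms of ultrafilters. -/
theorem exists_ultrafilter_isJSet (hS : IsDenseSubsemigroup S) (f : Filter S)
    (hf : ∀ B ∈ f, IsJSet S (Subtype.val '' B)) :
    ∃ q : Ultrafilter S, ↑q ≤ f ∧ ∀ B ∈ q, IsJSet S (Subtype.val '' B) := by
  let g : Filter S := Filter.comk (fun B => ¬ IsJSet S (Subtype.val '' B))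
    (by simpa using not_isJSet_empty hS)
    (fun B hB C hC h => hB (h.mono (Set.image_mono hC) (image_val_subset B)))
    (fun B hB C hC h => by
      rw [Set.image_union] at h
      exact (h.of_union hS.1).elim hB hC)
  have hne : (f ⊓ g).NeBot := by
    rw [Filter.inf_neBot_iff]
    intro B hB C hC
    by_contra hBC
    refine (Filter.mem_comk.1 hC) ((hf B hB).mono (Set.image_mono ?_) (image_val_subset _))
    exact Set.subset_compl_iff_disjoint_right.2
      (Set.disjoint_iff_inter_eq_empty.2 (Set.not_nonempty_iff_eq_empty.1 hBC))
  refine ⟨Ultrafilter.of (f ⊓ g), (Ultrafilter.of_le _).trans inf_le_left, fun B hB => ?_⟩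
  by_contra hJ
  have hBg : Bᶜ ∈ g := Filter.mem_comk.2 (by simpa using hJ)
  exact Ultrafilter.compl_mem_iff_notMem.1 ((Ultrafilter.of_le _).trans inf_le_right hBg) hB

theorem mem_jZero (hS : IsDenseSubsemigroup S) {p : Ultrafilter S}
    (hp : ∀ B ∈ p, IsJSet S (Subtype.val '' B)) : p ∈ jZero S := by
  refine ⟨fun ε hε => ?_, hp⟩
  by_contra hn
  obtain ⟨f, hf⟩ := hS.tauZero_nonempty
  obtain ⟨a, haS, ha, H, hH, -, h⟩ := (hp _ (Ultrafilter.compl_mem_iff_notMem.2 hn)).exists_small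
    (F := {f}) ⟨Finset.singleton_nonempty f, by simpa using hf⟩ (half_pos hε) 0
  obtain ⟨hlt, x, hx, hxe⟩ := h f (Finset.mem_singleton_self f)
  exact hx ⟨hS.1 _ x.2, by rw [hxe]; linarith⟩

/-! ### Chain sums of a C-set -/

/-- The sums `∑ i, (α (G i) + ∑ t ∈ H (G i), f i t)` along the nonempty finite chains
`G 0 ⊂ G 1 ⊂ ⋯` in `P_f(τ₀)` whose members strictly contain `K`. -/
def chainSums (S : AddSubsemigroup ℝ) (α : Finset (ℕ → ℝ) → ℝ) (H : Finset (ℕ → ℝ) → Finset ℕ)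
    (K : Finset (ℕ → ℝ)) : Set ℝ :=
  {x | ∃ m : ℕ, 0 < m ∧ ∃ (G : Fin m → Finset (ℕ → ℝ)) (f : Fin m → ℕ → ℝ),
    (∀ i, G i ∈ finTau S) ∧ (∀ i j, i < j → G i ⊂ G j) ∧ (∀ i, f i ∈ G i) ∧ (∀ i, K ⊂ G i) ∧
    x = ∑ i, (α (G i) + ∑ t ∈ H (G i), f i t)}

variable {α : Finset (ℕ → ℝ) → ℝ} {H : Finset (ℕ → ℝ) → Finset ℕ}

theorem chainSums_anti {K L : Finset (ℕ → ℝ)} (h : K ⊆ L) :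
    chainSums S α H L ⊆ chainSums S α H K := by
  rintro x ⟨m, hm, G, f, hG, hlt, hf, hL, rfl⟩
  exact ⟨m, hm, G, f, hG, hlt, hf, fun i => h.trans_ssubset (hL i), rfl⟩

/-- Chains may be concatenated once the second starts above the first. -/
theorem exists_add_mem_chainSums {K : Finset (ℕ → ℝ)} {x : ℝ} (hx : x ∈ chainSums S α H K) :
    ∃ L : Finset (ℕ → ℝ), (L : Set (ℕ → ℝ)) ⊆ tauZero S ∧
      ∀ y ∈ chainSums S α H L, x + y ∈ chainSums S α H K := by
  classical
  obtain ⟨m, hm, G, f, hG, hlt, hf, hK, rfl⟩ := hx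
  have hsub : ∀ i, G i ⊆ Finset.univ.biUnion G := fun i =>
    Finset.subset_biUnion_of_mem G (Finset.mem_univ i)
  refine ⟨Finset.univ.biUnion G, ?_, ?_⟩
  · intro g hg
    obtain ⟨i, -, hi⟩ := Finset.mem_biUnion.1 (Finset.mem_coe.1 hg)
    exact (hG i).2 hi
  · rintro y ⟨m', hm', G', f', hG', hlt', hf', hK', rfl⟩
    refine ⟨m + m', by omega, Fin.append G G', Fin.append f f', ?_, ?_, ?_, ?_, ?_⟩
    · intro i
      induction i using Fin.addCases with
      | left i => simpa using hG i
      | right i => simpa using hG' i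
    · intro i j hij
      induction i using Fin.addCases with
      | left i =>
        induction j using Fin.addCases with
        | left j => simpa using hlt i j hij
        | right j => simpa using (hsub i).trans_ssubset (hK' j)
      | right i =>
        induction j using Fin.addCases with
        | left j =>
          have := j.2
          simp only [Fin.lt_def, Fin.val_natAdd, Fin.val_castAdd] at hij
          omega
        | right j => simpa using hlt' i j ((Fin.natAdd_lt_natAdd_iff m).1 hij)
    · intro i
      induction i using Fin.addCases with
      | left i => simpa using hf i
      | right i => simpa using hf' i
    · intro i
      induction i using Fin.addCases with
      | left i => simpa using hK i
      | right i =>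
        simpa using ((hK ⟨0, hm⟩).trans_subset (hsub _)).trans (hK' i)
    · simp [Fin.sum_univ_add]

/-- Above any finite set of sequences there is a strictly increasing chain in `P_f(τ₀)`. -/
theorem IsDenseSubsemigroup.exists_chain (hS : IsDenseSubsemigroup S) {K : Finset (ℕ → ℝ)}
    (hK : (K : Set (ℕ → ℝ)) ⊆ tauZero S) :
    ∃ G : ℕ → Finset (ℕ → ℝ), StrictMono G ∧ ∀ n, G n ∈ finTau S ∧ K ⊂ G n := by
  classical
  have : NoMaxOrder {L : Finset (ℕ → ℝ) // (L : Set (ℕ → ℝ)) ⊆ tauZero S} := by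
    refine ⟨fun L => ?_⟩
    obtain ⟨g, hg, hgL⟩ := hS.exists_notMem L.2
    refine ⟨⟨insert g L.1, ?_⟩, Finset.ssubset_insert hgL⟩
    rw [Finset.coe_insert]
    exact Set.insert_subset hg L.2
  obtain ⟨G, hG, hG0⟩ := Nat.exists_strictMono'
    (⟨K, hK⟩ : {L : Finset (ℕ → ℝ) // (L : Set (ℕ → ℝ)) ⊆ tauZero S})
  have hKG : ∀ n, K ⊂ (G (n + 1)).1 := fun n => by
    have h := hG n.succ_pos
    rw [hG0] at h
    exact h
  exact ⟨fun n => (G (n + 1)).1, fun a b hab => hG (Nat.succ_lt_succ hab),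
    fun n => ⟨⟨(Finset.exists_of_ssubset (hKG n)).imp fun _ h => h.1, (G (n + 1)).2⟩, hKG n⟩⟩

/-- Although the bound `δ` is fixed, the elements `α (G i)` of a chain of length `m` have sum less
than `δ`, so that one of them is less than `δ / m`. Hence the sets of chain sums are J-sets near
zero. -/
theorem isJSet_chainSums (hS : IsDenseSubsemigroup S) {A : Set ℝ} {δ : ℝ} (hA : A ⊆ S)
    (hα : ∀ F ∈ finTau S, α F ∈ S ∧ α F < δ ∧ (H F).Nonempty)
    (hsum : ∀ m : ℕ, 0 < m → ∀ (G : Fin m → Finset (ℕ → ℝ)) (f : Fin m → ℕ → ℝ),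
        (∀ i, G i ∈ finTau S) → (∀ i j, i < j → G i ⊂ G j) → (∀ i, f i ∈ G i) →
        ∑ i, (α (G i) + ∑ t ∈ H (G i), f i t) ∈ A ∩ Set.Ioo 0 δ)
    {K : Finset (ℕ → ℝ)} (hK : (K : Set (ℕ → ℝ)) ⊆ tauZero S) :
    IsJSet S (chainSums S α H K) := by
  classical
  refine ⟨?_, fun F hF ε hε => ?_⟩
  · rintro x ⟨m, hm, G, f, hG, hlt, hf, -, rfl⟩
    exact hA (hsum m hm G f hG hlt hf).1
  obtain ⟨G, hG, hGK⟩ := hS.exists_chain (K := K ∪ F) (by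
    rw [Finset.coe_union]; exact Set.union_subset hK hF.2)
  obtain ⟨f, hf⟩ := hF.1
  have hFG : ∀ n, F ⊆ G n := fun n => Finset.subset_union_right.trans (hGK n).2.subset
  obtain ⟨m, hm⟩ := exists_nat_gt (δ / ε)
  have hex : ∃ n, α (G n) < ε := by
    by_contra! hall
    have h := (hsum (m + 1) m.succ_pos (fun i => G i) (fun _ => f) (fun i => (hGK i).1)
      (fun i j hij => hG hij) (fun i => hFG i hf)).2.2
    have h2 : ∑ _i : Fin (m + 1), ε ≤
        ∑ i : Fin (m + 1), (α (G i) + ∑ t ∈ H (G i), f t) :=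
      Finset.sum_le_sum fun i _ => le_add_of_le_of_nonneg (hall i)
        (Finset.sum_nonneg fun t _ => (hS.1 _ ((hF.2 hf).1 t)).le)
    rw [Finset.sum_const, Finset.card_univ, Fintype.card_fin, nsmul_eq_mul] at h2
    rw [div_lt_iff₀ hε] at hm
    push_cast at h2
    linarith
  obtain ⟨n, hn⟩ := hex
  obtain ⟨hαS, -, hH⟩ := hα _ (hGK n).1
  refine ⟨α (G n), ⟨hαS, hS.1 _ hαS, hn⟩, H (G n), hH, fun g hg => ?_⟩
  exact ⟨1, one_pos, fun _ => G n, fun _ => g, fun _ => (hGK n).1,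
    fun i j hij => absurd hij (by simp [Subsingleton.elim i j]), fun _ => hFG n hg,
    fun _ => Finset.subset_union_left.trans_ssubset (hGK n).2, by simp⟩

section
attribute [local instance] Ultrafilter.add Ultrafilter.addSemigroup

/-- Every C-set near zero belongs to an idempotent of `J₀(S)`: the ultrafilters of J-sets that
contain all `chainSums S α H K` form a nonempty compact subsemigroup of `βS`. -/
theorem IsCSet.exists_idempotent (hS : IsDenseSubsemigroup S) {A : Set ℝ} (hA : IsCSet S A) :
    ∃ p ∈ jZero S, p + p = p ∧ Subtype.val ⁻¹' A ∈ p := by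
  classical
  obtain ⟨hAS, hA⟩ := hA
  obtain ⟨α, H, hα, -, hsum⟩ := hA (1 / 2) (by norm_num) (by norm_num)
  let T : Finset (ℕ → ℝ) → Set S := fun K => Subtype.val ⁻¹' chainSums S α H K
  have hTJ : ∀ K : Finset (ℕ → ℝ), (K : Set (ℕ → ℝ)) ⊆ tauZero S →
      IsJSet S (Subtype.val '' T K) := fun K hK => by
    have h := isJSet_chainSums hS hAS hα hsum hK
    exact h.mono (fun x hx => ⟨⟨x, h.1 hx⟩, hx, rfl⟩) (image_val_subset _)
  let Z : Set (Ultrafilter S) :=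
    {q | (∀ K : Finset (ℕ → ℝ), (K : Set (ℕ → ℝ)) ⊆ tauZero S → T K ∈ q) ∧
      ∀ C : Set S, ¬ IsJSet S (Subtype.val '' C) → Cᶜ ∈ q}
  have hZJ : ∀ q ∈ Z, ∀ B ∈ q, IsJSet S (Subtype.val '' B) := fun q hq B hB => by
    by_contra hJ
    exact Ultrafilter.compl_mem_iff_notMem.1 (hq.2 B hJ) hB
  have hne : Z.Nonempty := by
    let f : Filter S :=
      { sets := {B | ∃ K : Finset (ℕ → ℝ), (K : Set (ℕ → ℝ)) ⊆ tauZero S ∧ T K ⊆ B}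
        univ_sets := ⟨∅, by simp, Set.subset_univ _⟩
        sets_of_superset := fun ⟨K, hK, h⟩ hBC => ⟨K, hK, h.trans hBC⟩
        inter_sets := fun ⟨K, hK, h⟩ ⟨L, hL, h'⟩ => ⟨K ∪ L, by
          rw [Finset.coe_union]; exact Set.union_subset hK hL, fun x hx =>
            ⟨h (chainSums_anti Finset.subset_union_left hx),
              h' (chainSums_anti Finset.subset_union_right hx)⟩⟩ }
    obtain ⟨q, hqf, hq⟩ := exists_ultrafilter_isJSet hS f fun B ⟨K, hK, h⟩ =>
      (hTJ K hK).mono (Set.image_mono h) (image_val_subset B)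
    exact ⟨q, fun K hK => hqf ⟨K, hK, subset_rfl⟩, fun C hC =>
      Ultrafilter.compl_mem_iff_notMem.2 fun h => hC (hq C h)⟩
  have hcl : IsClosed Z := by
    have h1 : IsClosed (⋂ (K : Finset (ℕ → ℝ)) (_ : (K : Set (ℕ → ℝ)) ⊆ tauZero S),
        {q : Ultrafilter S | T K ∈ q}) :=
      isClosed_iInter fun K => isClosed_iInter fun _ => ultrafilter_isClosed_basic _
    have h2 : IsClosed (⋂ (C : Set S) (_ : ¬ IsJSet S (Subtype.val '' C)),
        {q : Ultrafilter S | Cᶜ ∈ q}) :=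
      isClosed_iInter fun C => isClosed_iInter fun _ => ultrafilter_isClosed_basic _
    convert h1.inter h2 using 1
    ext q
    simp [Z]
  have hadd : ∀ q ∈ Z, ∀ r ∈ Z, q + r ∈ Z := by
    intro q hq r hr
    refine ⟨fun K hK => ?_, fun C hC => Ultrafilter.compl_mem_iff_notMem.2 fun hCqr => hC ?_⟩
    · refine (Ultrafilter.eventually_add q r (· ∈ T K)).2 ?_
      filter_upwards [hq.1 K hK] with x hx
      obtain ⟨L, hL, h⟩ := exists_add_mem_chainSums hx
      filter_upwards [hr.1 L hL] with y hy
      exact h y hy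
    · refine ⟨image_val_subset C, fun F hF δ hδ => ?_⟩
      have h1 := (Ultrafilter.eventually_add q r (· ∈ C)).1 hCqr
      have h2 := (mem_jZero hS (hZJ q hq)).1 (δ / 2) (half_pos hδ)
      obtain ⟨x, hx, -, hxδ⟩ := (h1.and h2).exists
      obtain ⟨b, ⟨hbS, -, hb⟩, H, hH, h⟩ := (hZJ r hr _ hx).2 F hF (δ / 2) (half_pos hδ)
      have hxb := S.add_mem x.2 hbS
      refine ⟨x + b, ⟨hxb, hS.1 _ hxb, by linarith⟩, H, hH, fun f hf => ?_⟩
      obtain ⟨y, hy, hye⟩ := h f hf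
      exact ⟨x + y, hy, by
        rw [add_assoc, ← hye]
        rfl⟩
  obtain ⟨p, hp, hpp⟩ := exists_idempotent_in_compact_add_subsemigroup
    Ultrafilter.continuous_add_left Z hne hcl.isCompact hadd
  refine ⟨p, mem_jZero hS (hZJ p hp), hpp, mem_of_superset (hp.1 ∅ (by simp)) ?_⟩
  rintro x ⟨m, hm, G, f, hG, hlt, hf, -, hx⟩
  rw [Set.mem_preimage, hx]
  exact (hsum m hm G f hG hlt hf).1

/-! ### Finite sums along an idempotent -/

theorem mem_of_idempotent {p : Ultrafilter S} (hp : p + p = p) {B : Set ℝ}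
    (hB : Subtype.val ⁻¹' B ∈ p) :
    Subtype.val ⁻¹' {x : ℝ | x ∈ B ∧ (Subtype.val ⁻¹' {y : ℝ | x + y ∈ B} : Set S) ∈ p} ∈ p := by
  have h : Subtype.val ⁻¹' B ∈ p + p := by rwa [hp]
  have h' := (Ultrafilter.eventually_add p p (· ∈ Subtype.val ⁻¹' B)).1 h
  filter_upwards [hB, h'] with x hx hx'
  exact ⟨hx, hx'⟩

/-- The recursion behind Hindman's theorem, for finitely many quantities `φ y w` depending on a
common choice `w`. The state is a member `B` of `p` together with a threshold `k`; the next state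
is `B ∩ ⋂ y ∈ Y, (-φ y w + B)` with a threshold above `k` and `rank w`. -/
theorem exists_seq_sum_mem {W κ : Type*} {p : Ultrafilter S} (hp : p + p = p) (Y : Finset κ)
    (φ : κ → W → ℝ) (R : ℕ → W → Prop) (rank : W → ℕ)
    (hstep : ∀ B : Set ℝ, Subtype.val ⁻¹' B ∈ p → ∀ k, ∃ w, R k w ∧ ∀ y ∈ Y, φ y w ∈ B)
    {A : Set ℝ} (hA : Subtype.val ⁻¹' A ∈ p) :
    ∃ (w : ℕ → W) (k : ℕ → ℕ), StrictMono k ∧ (∀ n, R (k n) (w n) ∧ rank (w n) ≤ k (n + 1)) ∧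
      ∀ F : Finset ℕ, F.Nonempty → ∀ y ∈ Y, ∑ n ∈ F, φ y (w n) ∈ A := by
  classical
  let X := {B : Set ℝ // (Subtype.val ⁻¹' B : Set S) ∈ p} × ℕ
  choose! c hcR hc using fun x : X => hstep _ (mem_of_idempotent hp x.1.2) x.2
  let next : X → X := fun x =>
    (⟨x.1.1 ∩ ⋂ y ∈ Y, {z | φ y (c x) + z ∈ x.1.1}, by
      rw [Set.preimage_inter, Set.preimage_iInter₂]
      exact inter_mem x.1.2 ((Filter.biInter_finset_mem Y).2 fun y hy => (hc x y hy).2)⟩,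
      max (x.2 + 1) (rank (c x)))
  let s : ℕ → X := fun n => next^[n] (⟨A, hA⟩, 0)
  have hs : ∀ n, s (n + 1) = next (s n) := fun n => Function.iterate_succ_apply' _ _ _
  have hanti : Antitone fun n => (s n).1.1 := antitone_nat_of_succ_le fun n => by
    simp only [hs]
    exact Set.inter_subset_left
  refine ⟨fun n => c (s n), fun n => (s n).2, strictMono_nat_of_lt_succ fun n => ?_,
    fun n => ⟨hcR _, ?_⟩, ?_⟩
  · simp only [hs]
    exact lt_of_lt_of_le (Nat.lt_succ_self _) (le_max_left _ _)
  · simp only [hs]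
    exact le_max_right _ _
  · have main : ∀ F : Finset ℕ, F.Nonempty → ∀ n, (∀ m ∈ F, n ≤ m) →
        ∀ y ∈ Y, ∑ m ∈ F, φ y (c (s m)) ∈ (s n).1.1 := by
      intro F
      induction F using Finset.induction_on_min with
      | empty => exact fun h => absurd h Finset.not_nonempty_empty
      | insert a F haF ih =>
        intro _ n hn y hy
        have han : n ≤ a := hn a (Finset.mem_insert_self a F)
        refine hanti han ?_
        rw [Finset.sum_insert fun h => lt_irrefl _ (haF a h)]
        rcases F.eq_empty_or_nonempty with rfl | hF
        · simpa using (hc (s a) y hy).1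
        · have h := ih hF (a + 1) (fun m hm => haF m hm) y hy
          rw [hs] at h
          exact Set.mem_iInter₂.1 h.2 y hy
    exact fun F hF y hy => main F hF 0 (fun _ _ => Nat.zero_le _) y hy

/-- A form of the central sets theorem near zero in which the translating elements are multiples
of `c`. As `0 ∉ S`, the zero sequence may not be used to make them multiples of `c`; instead the
J-set property is applied to `c • h` and `c • h + y` with an auxiliary `h ∈ τ₀`, and `c z` is the
sum obtained from `c • h`. -/
theorem exists_central_sequences (hS : IsDenseSubsemigroup S) {p : Ultrafilter S}
    (hpJ : p ∈ jZero S) (hp : p + p = p) {A : Set ℝ} (hA : Subtype.val ⁻¹' A ∈ p) {c : ℕ}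
    (hc0 : 0 < c) (hc : Subtype.val ⁻¹' ((fun s : ℝ => (c : ℝ) * s) '' (S : Set ℝ)) ∈ p)
    (Y : Finset (ℕ → ℝ)) (hY : ∀ y ∈ Y, y ∈ adjoinZeroTau S) :
    ∃ z ∈ tauZero S, ∃ H : ℕ → Finset ℕ, (∀ n, (H n).Nonempty) ∧
      (∀ m n, m < n → ∀ s ∈ H m, ∀ t ∈ H n, s < t) ∧
      (∀ y ∈ Y, ∀ n : ℕ, ∑ t ∈ H n, y t < 1 / ((n : ℝ) + 1)) ∧
      ∀ F : Finset ℕ, F.Nonempty → ∀ y ∈ Y,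
        c * ∑ n ∈ F, z n + ∑ n ∈ F, ∑ t ∈ H n, y t ∈ A := by
  classical
  obtain ⟨h, hh⟩ := hS.tauZero_nonempty
  have hch : c • h ∈ tauZero S := by
    obtain ⟨d, rfl⟩ := Nat.exists_eq_succ_of_ne_zero hc0.ne'
    rw [succ_nsmul']
    exact add_mem_tauZero hh (nsmul_mem (mem_adjoinZeroTau hh) d)
  have hc1 : (1 : ℝ) ≤ c := by exact_mod_cast hc0
  obtain ⟨w, k, hk, hR, hsum⟩ := exists_seq_sum_mem (W := ℝ × Finset ℕ) hp Y
    (fun y w => c * w.1 + ∑ t ∈ w.2, y t)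
    (fun k w => w.1 ∈ S ∧ w.1 < 1 / ((k : ℝ) + 1) ∧ w.2.Nonempty ∧ (∀ t ∈ w.2, k < t) ∧
      ∀ y ∈ Y, ∑ t ∈ w.2, y t < 1 / ((k : ℝ) + 1))
    (fun w => w.2.sup id) (fun B hB k => by
      have hδ : (0 : ℝ) < 1 / ((k : ℝ) + 1) := by positivity
      obtain ⟨a, haS, ha, H, hH, hkH, hF⟩ := (hpJ.2 _ (inter_mem hB hc)).exists_small
        (F := (insert 0 Y).image fun y => c • h + y)
        ⟨(Finset.insert_nonempty _ _).image _, by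
          intro g hg
          obtain ⟨y, hy, rfl⟩ := Finset.mem_image.1 (Finset.mem_coe.1 hg)
          refine add_mem_tauZero hch ?_
          rcases Finset.mem_insert.1 hy with rfl | hy
          · exact zero_mem _
          · exact hY y hy⟩ (half_pos hδ) k
      have hF' : ∀ y ∈ insert 0 Y, ∑ t ∈ H, (c • h + y) t < 1 / ((k : ℝ) + 1) / 2 ∧
          a + ∑ t ∈ H, (c • h + y) t ∈ Subtype.val '' (Subtype.val ⁻¹' B ∩
            Subtype.val ⁻¹' ((fun s : ℝ => (c : ℝ) * s) '' (S : Set ℝ)) : Set S) :=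
        fun y hy => hF _ (Finset.mem_image_of_mem _ hy)
      obtain ⟨hlt, x, ⟨-, z, hzS, hz⟩, hx⟩ := hF' 0 (Finset.mem_insert_self _ _)
      have hz0 : 0 < z := hS.1 z hzS
      simp only [add_zero] at hlt hx
      simp only at hz
      have hsplit : ∀ y : ℕ → ℝ, ∑ t ∈ H, (c • h + y) t = ∑ t ∈ H, (c • h) t + ∑ t ∈ H, y t :=
        fun y => by simp only [Pi.add_apply, Finset.sum_add_distrib]
      have hch0 : 0 < ∑ t ∈ H, (c • h) t := Finset.sum_pos (fun t _ => hS.1 _ (hch.1 t)) hH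
      refine ⟨(z, H), ⟨hzS, ?_, hH, hkH, fun y hy => ?_⟩, fun y hy => ?_⟩
      · have : z ≤ c * z := le_mul_of_one_le_left hz0.le hc1
        simp only
        linarith
      · have h1 := (hF' y (Finset.mem_insert_of_mem hy)).1
        rw [hsplit] at h1
        simp only
        linarith
      · obtain ⟨-, x', hx', hxe⟩ := hF' y (Finset.mem_insert_of_mem hy)
        rw [hsplit, ← add_assoc, ← hx, ← hz] at hxe
        rw [← hxe]
        exact hx'.1) hA
  have hle : ∀ n : ℕ, 1 / ((k n : ℝ) + 1) ≤ 1 / ((n : ℝ) + 1) := fun n =>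
    one_div_le_one_div_of_le (by positivity) (by
      have : (n : ℝ) ≤ k n := by exact_mod_cast hk.le_apply
      linarith)
  refine ⟨fun n => (w n).1, mem_tauZero_of_lt hS.1 (fun n => (hR n).1.1)
    (fun n => (hR n).1.2.1.trans_le (hle n)), fun n => (w n).2, fun n => (hR n).1.2.2.1,
    fun m n hmn s hs t ht => ?_, fun y hy n => ((hR n).1.2.2.2.2 y hy).trans_le (hle n),
    fun F hF y hy => ?_⟩
  · calc s ≤ (w m).2.sup id := Finset.le_sup (f := id) hs
      _ ≤ k (m + 1) := (hR m).2
      _ ≤ k n := hk.monotone hmn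
      _ < t := (hR n).1.2.2.2.1 t ht
  · rw [Finset.mul_sum, ← Finset.sum_add_distrib]
    exact hsum F hF y hy

/-! ### Induction on the number of columns -/

/-- The theorem for a fixed idempotent and an arbitrary index type of rows. -/
theorem exists_sequences_of_idempotent (hS : IsDenseSubsemigroup S) {p : Ultrafilter S}
    (hpJ : p ∈ jZero S) (hp : p + p = p) {A : Set ℝ} (hA : Subtype.val ⁻¹' A ∈ p) :
    ∀ (v : ℕ) {ι : Type} [Finite ι] (M : ι → Fin v → ℕ) (d : Fin v → ℕ),
      (∀ l, 0 < d l ∧ Subtype.val ⁻¹' ((fun s : ℝ => (d l : ℝ) * s) '' (S : Set ℝ)) ∈ p) →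
      (∀ i, ∃ j, M i j ≠ 0) →
      (∀ i l, M i l ≠ 0 → (∀ j < l, M i j = 0) → M i l = d l) →
      ∃ x : Fin v → ℕ → ℝ, (∀ j, x j ∈ tauZero S) ∧
        ∀ F : Finset ℕ, F.Nonempty → ∀ i, ∑ j, (M i j : ℝ) * ∑ n ∈ F, x j n ∈ A := by
  classical
  intro v
  induction v with
  | zero =>
    intro ι _ M d _ hM _
    exact ⟨fun j => j.elim0, fun j => j.elim0, fun F _ i => (hM i).choose.elim0⟩
  | succ v ih =>
    intro ι _ M d hd hM hMd
    have := Fintype.ofFinite ι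
    -- the rows that vanish in the first column form a matrix with `v` columns
    obtain ⟨x, hx, hxA⟩ := ih (ι := {i // M i 0 = 0}) (fun i l => M i l.succ) (fun l => d l.succ)
      (fun l => hd l.succ)
      (fun i => by
        obtain ⟨j, hj⟩ := hM i
        induction j using Fin.cases with
        | zero => exact absurd i.2 hj
        | succ j => exact ⟨j, hj⟩)
      (fun i l hl hlt => hMd i l.succ hl fun j hj => by
        induction j using Fin.cases with
        | zero => exact i.2
        | succ j => exact hlt j (Fin.succ_lt_succ_iff.1 hj))
    let y : ι → ℕ → ℝ := fun i => ∑ j, M i (Fin.succ j) • x j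
    -- the sequences `x j` are included for the sake of the bound on `∑ t ∈ H n, x j t`
    obtain ⟨z, hz, H, hH, hHlt, hsmall, hsum⟩ := exists_central_sequences hS hpJ hp hA
      (hd 0).1 (hd 0).2 (Finset.univ.image y ∪ Finset.univ.image x) (by
        intro g hg
        rcases Finset.mem_union.1 hg with hg | hg
        · obtain ⟨i, -, rfl⟩ := Finset.mem_image.1 hg
          exact sum_mem fun j _ => nsmul_mem (mem_adjoinZeroTau (hx j)) _
        · obtain ⟨j, -, rfl⟩ := Finset.mem_image.1 hg
          exact mem_adjoinZeroTau (hx j))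
    refine ⟨Fin.cons z fun j n => ∑ t ∈ H n, x j t, ?_, ?_⟩
    · intro j
      induction j using Fin.cases with
      | zero => exact hz
      | succ j =>
        exact mem_tauZero_of_lt hS.1 (fun n => sum_mem_of_nonempty (hH n) fun t _ => (hx j).1 t)
          (hsmall _ (Finset.mem_union_right _ (Finset.mem_image_of_mem x (Finset.mem_univ j))))
    · intro F hF i
      simp only [Fin.sum_univ_succ, Fin.cons_zero, Fin.cons_succ]
      by_cases hi : M i 0 = 0
      · have hdisj : (F : Set ℕ).PairwiseDisjoint H := by
          intro m _ n _ hmn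
          rw [Function.onFun, Finset.disjoint_left]
          intro s hs ht
          rcases lt_or_gt_of_ne hmn with h | h
          · exact lt_irrefl s (hHlt m n h s hs s ht)
          · exact lt_irrefl s (hHlt n m h s ht s hs)
        have h := hxA (F.biUnion H) (hF.biUnion fun n _ => hH n) ⟨i, hi⟩
        simp only [Finset.sum_biUnion hdisj] at h
        simpa [hi] using h
      · have h := hsum F hF (y i)
          (Finset.mem_union_left _ (Finset.mem_image_of_mem y (Finset.mem_univ i)))
        have hy : ∑ n ∈ F, ∑ t ∈ H n, y i t =
            ∑ j : Fin v, (M i j.succ : ℝ) * ∑ n ∈ F, ∑ t ∈ H n, x j t := by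
          simp only [y, Finset.sum_apply, nsmul_eq_mul, Finset.mul_sum]
          exact (Finset.sum_congr rfl fun n _ => Finset.sum_comm).trans Finset.sum_comm
        rw [hy] at h
        rwa [hMd i 0 hi fun j hj => absurd hj (Fin.not_lt_zero j)]

end

end NearZero

theorem theorem2p8 (S : AddSubsemigroup ℝ) (hS : NearZero.IsDenseSubsemigroup S)
    (u v : ℕ) (M : Matrix (Fin u) (Fin v) ℕ)
    (hM : NearZero.IsFirstEntriesMatrix (M.map (fun k : ℕ => (k : ℚ))))
    (A : Set ℝ) (hA : NearZero.IsCSet S A)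
    (hc : ∀ c : ℕ, NearZero.IsFirstEntry M c →
      NearZero.IsCStarSet S ((fun s : ℝ => (c : ℝ) * s) '' (S : Set ℝ))) :
    ∃ x : Fin v → ℕ → ℝ, (∀ j, x j ∈ NearZero.tauZero S) ∧
      ∀ F : Finset ℕ, F.Nonempty →
        (∀ j, ∑ n ∈ F, x j n ∈ (S : Set ℝ) \ {0}) ∧
        ∀ i, (M.map (fun k : ℕ => (k : ℝ))).mulVec (fun j => ∑ n ∈ F, x j n) i ∈ A := by
  classical
  obtain ⟨p, hpJ, hp, hAp⟩ := hA.exists_idempotent hS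
  obtain ⟨hrow, q, -, hq⟩ := hM
  simp only [Matrix.map_apply, ne_eq, Nat.cast_eq_zero] at hrow hq
  -- a column without first entries imposes no condition and is given the coefficient `1`
  have hd : ∀ l, ∃ d : ℕ, (0 < d ∧
      Subtype.val ⁻¹' ((fun s : ℝ => (d : ℝ) * s) '' (S : Set ℝ)) ∈ p) ∧
      ∀ i, M i l ≠ 0 → (∀ j < l, M i j = 0) → M i l = d := by
    intro l
    by_cases h : ∃ i, M i l ≠ 0 ∧ ∀ j < l, M i j = 0
    · obtain ⟨i, hi, hlt⟩ := h
      refine ⟨M i l, ⟨Nat.pos_of_ne_zero hi, (hc _ ⟨i, l, rfl, hi, hlt⟩).2 p hpJ hp⟩, ?_⟩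
      intro i' hi' hlt'
      exact_mod_cast (hq i' l hi' hlt').trans (hq i l hi hlt).symm
    · refine ⟨1, ⟨one_pos, ?_⟩, fun i hi hlt => absurd ⟨i, hi, hlt⟩ h⟩
      exact Filter.mem_of_superset Filter.univ_mem fun s _ => ⟨s, s.2, by simp⟩
  choose d hd hMd using hd
  obtain ⟨x, hx, hxA⟩ := NearZero.exists_sequences_of_idempotent hS hpJ hp hAp v M d hd hrow
    fun i l => hMd l i
  refine ⟨x, hx, fun F hF => ⟨fun j => ?_, fun i => hxA F hF i⟩⟩
  have hS' := NearZero.sum_mem_of_nonempty hF fun n _ => (hx j).1 n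
  exact ⟨hS', (hS.1 _ hS').ne'⟩
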